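/- Let $n^\star\ge 1$ be an integer, $h^\star=\frac{\pi}{2n^\star}$, $k_0>0$, and let $S=\{k\in\mathbb C:\ \operatorname{Re}k>0,\ |\operatorname{Im}k|<h^\star\}$. There is exactly one function $w_0(\cdot,k_0):\overline S\to\mathbb R$ (the harmonic measure of the slit $(0,k_0]$ with respect to $S\setminus(0,k_0]$) that is harmonic and bounded in $S\setminus(0,k_0]$, continuous on $\overline S\setminus\{0\}$, equal to $0$ on $\partial S$ and equal to $1$ on $(0,k_0]$. It satisfies $$\frac{2}{\pi}\arctan\left(\frac{(e^{k_0}-1)^{n^\star}}{\sqrt{(e^k-1)^{2n^\star}-(e^{k_0}-1)^{2n^\star}}}\right)\le w_0(k,k_0)\le\frac{2}{\pi}\arctan\left(\min\left\{\frac{k_0}{\sqrt{k^2-k_0^2}},\ \frac{e^{k_0n^\star}}{\sqrt{e^{2kn^\star}-e^{2k_0n^\star}}}\right\}\right)$$ for all real $k\ge k_0$, where at $k=k_0$ both bounds are read as $\frac2\pi\arctan(+\infty)=1$, so that the claim there is $w_0(k_0,k_0)=1$. -/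

import Mathlib

/-- The half-strip `{k ∈ ℂ : Re k > 0, |Im k| < h}`. -/
def halfStrip (h : ℝ) : Set ℂ := {k : ℂ | 0 < k.re ∧ |k.im| < h}

/-- The slit `(0, k₀] × {0}` on the real axis, as a subset of `ℂ`. -/
def slit (k₀ : ℝ) : Set ℂ := {k : ℂ | k.im = 0 ∧ 0 < k.re ∧ k.re ≤ k₀}

/-- `w` is the harmonic measure of the slit `(0, k₀]` with respect to the slit half-strip
`{Re k > 0, |Im k| < h} \ (0, k₀]`: a bounded solution of the Dirichlet problem with boundary
value `1` on the slit and `0` on the boundary of the half-strip.  The boundary values are attained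
continuously at every boundary point other than `0`, the only point at which they jump; at each
point of the slit this covers the approach from both sides. -/
structure IsSlitHarmonicMeasure (h k₀ : ℝ) (w : ℂ → ℝ) : Prop where
  harmonic : InnerProductSpace.HarmonicOnNhd w (halfStrip h \ slit k₀)
  bounded : ∃ M : ℝ, ∀ k ∈ halfStrip h \ slit k₀, |w k| ≤ M
  continuousOn : ContinuousOn w (closure (halfStrip h) \ {0})
  eq_zero : ∀ k ∈ frontier (halfStrip h), w k = 0
  eq_one : ∀ k ∈ slit k₀, w k = 1

/-! The harmonic measure is explicit: `w₀(k) = (2/π) Re arcsin (sinh (n k₀) / sinh (n k))`. Since `h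
= π/(2n)`, `sinh (n k)` maps the half-strip conformally onto the right half-plane; the quotient
carries the slit to `[1, ∞)`, and `arcsin` opens the slit half-plane into the strip `0 < Re < π/2`.
Uniqueness is a Phragmén–Lindelöf argument: a barrier infinite at `0` and `∞` absorbs the jump at
`0` and the unboundedness of the domain (`IsSlitHarmonicMeasure.sub_le_barrier`). By
`Real.arctan_div_sqrt` every bound is an arcsine of a quotient, so the estimates become comparisons
of `sinh (n k₀) / sinh (n k)` with three elementary quotients. -/

open Set Filter Topology

/-! ### The maximum principle -/

/-- A harmonic function that has a local maximum in the plane is locally constant. -/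
theorem InnerProductSpace.HarmonicAt.eventually_eq_of_isLocalMax {f : ℂ → ℝ} {c : ℂ}
    (hf : InnerProductSpace.HarmonicAt f c) (hc : IsLocalMax f c) : ∀ᶠ z in 𝓝 c, f z = f c := by
  obtain ⟨r, hr, hball⟩ := Metric.eventually_nhds_iff_ball.1 hf.eventually
  obtain ⟨F, hF, hFf⟩ :=
    InnerProductSpace.HarmonicOnNhd.exists_analyticOnNhd_ball_re_eq (f := f) (z := c) (R := r)
      (fun z hz => hball z hz)
  have hmem : Metric.ball c r ∈ 𝓝 c := Metric.ball_mem_nhds c hr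
  -- As `f = Re F` locally, `|exp F| = exp f`, and the maximum modulus principle applies to `exp F`.
  have hnorm : ∀ z ∈ Metric.ball c r, ‖Complex.exp (F z)‖ = Real.exp (f z) := fun z hz => by
    rw [Complex.norm_exp]
    exact congrArg Real.exp (hFf hz)
  have hcc : c ∈ Metric.ball c r := Metric.mem_ball_self hr
  have hd : ∀ᶠ z in 𝓝 c, DifferentiableAt ℂ (fun z => Complex.exp (F z)) z := by
    filter_upwards [hmem] with z hz
    exact (hF z hz).differentiableAt.cexp
  have hmax : IsLocalMax (norm ∘ fun z => Complex.exp (F z)) c := by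
    filter_upwards [hmem, hc] with z hz hzc
    simp only [Function.comp, hnorm z hz, hnorm c hcc]
    exact Real.exp_le_exp.2 hzc
  filter_upwards [Complex.norm_eventually_eq_of_isLocalMax hd hmax, hmem] with z hz hzb
  rw [hnorm z hzb, hnorm c hcc] at hz
  exact Real.exp_injective hz

/-- Weak maximum principle: a function continuous on a compact set `K`, harmonic on an open subset
`U` and nonpositive on `K \ U` is nonpositive on `K`. -/
theorem InnerProductSpace.HarmonicOnNhd.nonpos_of_isCompact {f : ℂ → ℝ} {K U : Set ℂ}
    (hK : IsCompact K) (hU : IsOpen U) (hUK : U ⊆ K) (hf : ContinuousOn f K)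
    (hh : InnerProductSpace.HarmonicOnNhd f U) (hb : ∀ z ∈ K \ U, f z ≤ 0) :
    ∀ z ∈ K, f z ≤ 0 := by
  intro z₀ hz₀
  by_contra! hpos
  obtain ⟨p, hpK, hp⟩ := hK.exists_isMaxOn ⟨z₀, hz₀⟩ hf
  have hcl : IsCompact (K ∩ f ⁻¹' {f p}) :=
    hK.of_isClosed_subset (hf.preimage_isClosed_of_isClosed hK.isClosed isClosed_singleton)
      inter_subset_left
  -- `q` is a rightmost maximum point; local constancy of `f` near `q` would produce one further
  -- right.
  obtain ⟨q, ⟨hqK, hqp⟩, hq⟩ :=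
    hcl.exists_isMaxOn ⟨p, hpK, rfl⟩ Complex.continuous_re.continuousOn
  have hqp : f q = f p := hqp
  have hqU : q ∈ U := by
    by_contra h
    have h1 := hb q ⟨hqK, h⟩
    have h2 : f z₀ ≤ f p := hp hz₀
    linarith
  have hloc : IsLocalMax f q := by
    filter_upwards [hU.mem_nhds hqU] with z hz
    rw [hqp]
    exact hp (hUK hz)
  have hev := ((hh q hqU).eventually_eq_of_isLocalMax hloc).and (hU.mem_nhds hqU)
  obtain ⟨r, hr, hball⟩ := Metric.eventually_nhds_iff_ball.1 hev
  have hmem : q + ((r / 2 : ℝ) : ℂ) ∈ Metric.ball q r := by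
    rw [mem_ball_iff_norm, add_sub_cancel_left, Complex.norm_real, Real.norm_eq_abs,
      abs_of_pos (by positivity)]
    linarith
  obtain ⟨h1, h2⟩ := hball _ hmem
  have h3 : (q + ((r / 2 : ℝ) : ℂ)).re ≤ q.re := hq ⟨hUK h2, h1.trans hqp⟩
  rw [Complex.add_re, Complex.ofReal_re] at h3
  linarith

/-! ### The half-strip -/

theorem halfStrip_eq_reProdIm (h : ℝ) : halfStrip h = Ioi 0 ×ℂ Ioo (-h) h := by
  ext k
  simp [halfStrip, Complex.mem_reProdIm, abs_lt]

theorem isOpen_halfStrip (h : ℝ) : IsOpen (halfStrip h) := by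
  rw [halfStrip_eq_reProdIm]
  exact isOpen_Ioi.reProdIm isOpen_Ioo

theorem mem_closure_halfStrip {h : ℝ} (hh : 0 < h) {k : ℂ} :
    k ∈ closure (halfStrip h) ↔ 0 ≤ k.re ∧ |k.im| ≤ h := by
  rw [halfStrip_eq_reProdIm, Complex.closure_reProdIm, closure_Ioi,
    closure_Ioo (by linarith), Complex.mem_reProdIm, mem_Ici, mem_Icc, abs_le]

theorem mem_frontier_halfStrip {h : ℝ} (hh : 0 < h) {k : ℂ} :
    k ∈ frontier (halfStrip h) ↔ (0 ≤ k.re ∧ |k.im| ≤ h) ∧ (k.re = 0 ∨ |k.im| = h) := by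
  rw [frontier, (isOpen_halfStrip h).interior_eq, Set.mem_sdiff, mem_closure_halfStrip hh]
  refine and_congr_right fun ⟨h1, h2⟩ => ?_
  simp only [halfStrip, mem_ofPred_eq, not_and_or, not_lt]
  exact or_congr ⟨fun h => le_antisymm h h1, fun h => h.le⟩ ⟨fun h => le_antisymm h2 h, fun h => h.ge⟩

theorem isOpen_halfStrip_diff_slit (h k₀ : ℝ) : IsOpen (halfStrip h \ slit k₀) := by
  have : halfStrip h \ slit k₀ = halfStrip h \ {k : ℂ | k.im = 0 ∧ k.re ≤ k₀} := by
    ext k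
    simp only [halfStrip, slit, Set.mem_sdiff, mem_ofPred_eq]
    tauto
  rw [this]
  refine (isOpen_halfStrip h).sdiff ?_
  exact (isClosed_eq Complex.continuous_im continuous_const).inter
    (isClosed_le Complex.continuous_re continuous_const)

/-! ### Uniqueness -/

/-- `h - log |k| + 2 Re k` is a positive harmonic function on the half-strip which tends to
infinity at `0` and at `∞`. -/
theorem one_add_re_le_barrier {h : ℝ} {k : ℂ} (hk : k ≠ 0) (hre : 0 ≤ k.re) (him : |k.im| ≤ h) :
    1 + k.re ≤ h - Real.log ‖k‖ + 2 * k.re := by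
  have h1 := Real.log_le_sub_one_of_pos (norm_pos_iff.2 hk)
  have h2 := Complex.norm_le_abs_re_add_abs_im k
  rw [abs_of_nonneg hre] at h2
  linarith

theorem IsSlitHarmonicMeasure.sub_le_barrier {h k₀ : ℝ} (hh : 0 < h) {w₁ w₂ : ℂ → ℝ}
    (h₁ : IsSlitHarmonicMeasure h k₀ w₁) (h₂ : IsSlitHarmonicMeasure h k₀ w₂) {k : ℂ}
    (hk : k ∈ closure (halfStrip h)) (hk0 : k ≠ 0) {ε : ℝ} (hε : 0 < ε) :
    w₁ k - w₂ k ≤ ε * (h - Real.log ‖k‖ + 2 * k.re) := by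
  obtain ⟨M₁, hM₁⟩ := h₁.bounded
  obtain ⟨M₂, hM₂⟩ := h₂.bounded
  -- `ε * L` bounds `w₁ - w₂` off the slit. With these `R` and `δ` the barrier is at least `L` where
  -- `‖z‖ = δ` or `Re z = R`, and `k` stays in the truncated region.
  set L : ℝ := (M₁ + M₂) / ε with hL
  set R : ℝ := max L k.re
  set δ : ℝ := min (Real.exp (-L)) ‖k‖
  have hδ : 0 < δ := lt_min (Real.exp_pos _) (norm_pos_iff.2 hk0)
  set K : Set ℂ := {z | (0 ≤ z.re ∧ |z.im| ≤ h) ∧ δ ≤ ‖z‖ ∧ z.re ≤ R}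
  set U : Set ℂ := (halfStrip h \ slit k₀) ∩ {z | δ < ‖z‖ ∧ z.re < R}
  have hK0 : ∀ z ∈ K, z ≠ 0 := fun z hz => norm_pos_iff.1 (hδ.trans_le hz.2.1)
  have hUK : U ⊆ K := fun z hz =>
    ⟨⟨hz.1.1.1.le, hz.1.1.2.le⟩, hz.2.1.le, hz.2.2.le⟩
  have hKc : IsCompact K := by
    refine (isCompact_Icc.reProdIm isCompact_Icc : IsCompact (Icc 0 R ×ℂ Icc (-h) h)).of_isClosed_subset
      ?_ fun z hz => ⟨⟨hz.1.1, hz.2.2⟩, abs_le.1 hz.1.2⟩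
    exact ((isClosed_le continuous_const Complex.continuous_re).inter
      (isClosed_le Complex.continuous_im.abs continuous_const)).inter
      ((isClosed_le continuous_const continuous_norm).inter
        (isClosed_le Complex.continuous_re continuous_const))
  have hUo : IsOpen U := (isOpen_halfStrip_diff_slit h k₀).inter
    ((isOpen_lt continuous_const continuous_norm).inter
      (isOpen_lt Complex.continuous_re continuous_const))
  have hcl : K ⊆ closure (halfStrip h) \ {0} := fun z hz =>
    ⟨(mem_closure_halfStrip hh).2 hz.1, hK0 z hz⟩
  have hbar : ∀ z ∈ K, 0 ≤ ε * (h - Real.log ‖z‖ + 2 * z.re) := fun z hz => by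
    have := one_add_re_le_barrier (hK0 z hz) hz.1.1 hz.1.2
    exact mul_nonneg hε.le (by linarith [hz.1.1])
  have hcont : ContinuousOn
      (fun z => (w₁ z - w₂ z) - ε * (h - Real.log ‖z‖ + 2 * z.re)) K := by
    refine ((h₁.continuousOn.mono hcl).sub (h₂.continuousOn.mono hcl)).sub ?_
    refine continuousOn_const.mul (.add (.sub continuousOn_const ?_) ?_)
    · exact continuous_norm.continuousOn.log fun z hz => norm_ne_zero_iff.2 (hK0 z hz)
    · exact (continuous_const.mul Complex.continuous_re).continuousOn
  have hharm : InnerProductSpace.HarmonicOnNhd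
      (fun z => (w₁ z - w₂ z) - ε * (h - Real.log ‖z‖ + 2 * z.re)) U := by
    intro z hz
    have hz0 : z ≠ 0 := hK0 z (hUK hz)
    have hlog : InnerProductSpace.HarmonicAt (fun z : ℂ => Real.log ‖z‖) z :=
      AnalyticAt.harmonicAt_log_norm (f := fun z => z) analyticAt_id hz0
    have hre : InnerProductSpace.HarmonicAt (fun z : ℂ => z.re) z :=
      AnalyticAt.harmonicAt_re (f := fun z => z) analyticAt_id
    have hc : InnerProductSpace.HarmonicAt (fun _ : ℂ => h) z :=
      InnerProductSpace.harmonicAt_const h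
    exact ((h₁.harmonic z hz.1).sub (h₂.harmonic z hz.1)).sub
      (((hc.sub hlog).add (hre.const_smul (c := (2 : ℝ)))).const_smul (c := ε))
  have hbd : ∀ z ∈ K \ U, (w₁ z - w₂ z) - ε * (h - Real.log ‖z‖ + 2 * z.re) ≤ 0 := by
    rintro z ⟨hzK, hzU⟩
    have hb := hbar z hzK
    by_cases hzS : z ∈ halfStrip h
    · by_cases hzs : z ∈ slit k₀
      · rw [h₁.eq_one z hzs, h₂.eq_one z hzs]
        linarith
      · have hzD : z ∈ halfStrip h \ slit k₀ := ⟨hzS, hzs⟩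
        have hM : w₁ z - w₂ z ≤ ε * L := by
          have e1 := (abs_le.1 (hM₁ z hzD)).2
          have e2 := (abs_le.1 (hM₂ z hzD)).1
          rw [hL, mul_div_cancel₀ _ hε.ne']
          linarith
        have hLb : L ≤ h - Real.log ‖z‖ + 2 * z.re := by
          by_cases hzδ : δ < ‖z‖
          · have hzR : R ≤ z.re := not_lt.1 fun hlt => hzU ⟨hzD, hzδ, hlt⟩
            have := one_add_re_le_barrier (hK0 z hzK) hzK.1.1 hzK.1.2
            linarith [le_max_left L k.re]
          · have h3 : ‖z‖ ≤ Real.exp (-L) := (not_lt.1 hzδ).trans (min_le_left _ _)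
            have h4 := Real.log_le_log (norm_pos_iff.2 (hK0 z hzK)) h3
            rw [Real.log_exp] at h4
            linarith [hzK.1.1]
        have := mul_le_mul_of_nonneg_left hLb hε.le
        linarith
    · have hzF : z ∈ frontier (halfStrip h) := by
        rw [frontier, (isOpen_halfStrip h).interior_eq]
        exact ⟨(mem_closure_halfStrip hh).2 hzK.1, hzS⟩
      rw [h₁.eq_zero z hzF, h₂.eq_zero z hzF]
      linarith
  have := hharm.nonpos_of_isCompact hKc hUo hUK hcont hbd k
    ⟨(mem_closure_halfStrip hh).1 hk, min_le_right _ _, le_max_right _ _⟩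
  linarith

theorem IsSlitHarmonicMeasure.le {h k₀ : ℝ} (hh : 0 < h) {w₁ w₂ : ℂ → ℝ}
    (h₁ : IsSlitHarmonicMeasure h k₀ w₁) (h₂ : IsSlitHarmonicMeasure h k₀ w₂) {k : ℂ}
    (hk : k ∈ closure (halfStrip h)) : w₁ k ≤ w₂ k := by
  by_cases hk0 : k = 0
  · have hkF : k ∈ frontier (halfStrip h) := by
      rw [mem_frontier_halfStrip hh]
      simp [hk0, hh.le]
    rw [h₁.eq_zero k hkF, h₂.eq_zero k hkF]
  · obtain ⟨hre, him⟩ := (mem_closure_halfStrip hh).1 hk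
    have hg : 0 < h - Real.log ‖k‖ + 2 * k.re := by
      linarith [one_add_re_le_barrier hk0 hre him]
    refine le_of_forall_pos_le_add fun ε hε => ?_
    have := h₁.sub_le_barrier hh h₂ hk hk0 (div_pos hε hg)
    rw [div_mul_cancel₀ _ hg.ne'] at this
    linarith

theorem IsSlitHarmonicMeasure.eqOn {h k₀ : ℝ} (hh : 0 < h) {w₁ w₂ : ℂ → ℝ}
    (h₁ : IsSlitHarmonicMeasure h k₀ w₁) (h₂ : IsSlitHarmonicMeasure h k₀ w₂) :
    EqOn w₁ w₂ (closure (halfStrip h)) := fun _ hk =>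
  le_antisymm (h₁.le hh h₂ hk) (h₂.le hh h₁ hk)

/-! ### The real part of the complex arcsine -/

/-- The real part of the principal branch of `arcsin`, extended continuously across the cuts. -/
noncomputable def reArcsin (z : ℂ) : ℝ := Real.arcsin ((‖1 + z‖ - ‖1 - z‖) / 2)

theorem continuous_reArcsin : Continuous reArcsin := by
  unfold reArcsin
  fun_prop

/-- Replacing `(x, y)` by `(-x, -y)` and subtracting leaves `2 sin x`, which explains the formula
for `reArcsin`. -/
theorem Complex.norm_one_add_sin (x y : ℝ) :
    ‖1 + Complex.sin (x + y * Complex.I)‖ = Real.cosh y + Real.sin x := by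
  have hnn : 0 ≤ Real.cosh y + Real.sin x := by
    linarith [Real.one_le_cosh y, Real.neg_one_le_sin x]
  have e : 1 + Complex.sin (x + y * Complex.I) = ((1 + Real.sin x * Real.cosh y : ℝ) : ℂ) +
      ((Real.cos x * Real.sinh y : ℝ) : ℂ) * Complex.I := by
    rw [Complex.sin_add_mul_I]
    push_cast
    ring
  rw [← sq_eq_sq₀ (norm_nonneg _) hnn, Complex.sq_norm, e, Complex.normSq_add_mul_I, mul_pow,
    Real.cos_sq', Real.sinh_sq]
  ring

theorem reArcsin_sin {α : ℂ} (h₁ : -(Real.pi / 2) ≤ α.re) (h₂ : α.re ≤ Real.pi / 2) :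
    reArcsin (Complex.sin α) = α.re := by
  have e1 := Complex.norm_one_add_sin α.re α.im
  have e2 := Complex.norm_one_add_sin (-α.re) (-α.im)
  rw [Complex.re_add_im] at e1
  have e3 : ((-α.re : ℝ) : ℂ) + ((-α.im : ℝ) : ℂ) * Complex.I = -α := by
    conv_rhs => rw [← Complex.re_add_im α]
    push_cast
    ring
  rw [e3, Complex.sin_neg, ← sub_eq_add_neg, Real.cosh_neg, Real.sin_neg] at e2
  rw [reArcsin, e1, e2, ← Real.arcsin_sin h₁ h₂]
  congr 1
  rw [Real.arcsin_sin h₁ h₂]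
  ring

theorem Complex.re_sqrt_pos {z : ℂ} (hz : z ∈ Complex.slitPlane) : 0 < (z ^ (1 / 2 : ℂ)).re := by
  have hz0 := Complex.slitPlane_ne_zero hz
  rw [Complex.cpow_def_of_ne_zero hz0, Complex.exp_re]
  refine mul_pos (Real.exp_pos _) (Real.cos_pos_of_mem_Ioo ?_)
  have him : (Complex.log z * (1 / 2)).im = Complex.arg z / 2 := by
    rw [show (1 / 2 : ℂ) = ((1 / 2 : ℝ) : ℂ) by norm_num, Complex.im_mul_ofReal, Complex.log_im]
    ring
  rw [him]
  have h1 := Complex.neg_pi_lt_arg z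
  have h2 := (Complex.mem_slitPlane_iff_arg.1 hz).1
  have h3 := (Complex.arg_le_pi z).lt_of_ne h2
  constructor <;> linarith

/-- With the principal square root, `√(1 - z²) + i z` lies in the right half-plane. -/
theorem Complex.re_sqrt_add_mul_I_pos {z q : ℂ} (hq : 0 < q.re) (hqz : q ^ 2 = 1 - z ^ 2) :
    0 < (q + z * Complex.I).re := by
  -- The two factors are mutually inverse, so their real parts have the same sign, and these sum to
  -- `2 Re q > 0`.
  have hmul : (q + z * Complex.I) * (q - z * Complex.I) = 1 := by
    linear_combination hqz - z ^ 2 * Complex.I_sq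
  have hne : q + z * Complex.I ≠ 0 := left_ne_zero_of_mul_eq_one hmul
  have hinv : q - z * Complex.I = (q + z * Complex.I)⁻¹ := eq_inv_of_mul_eq_one_right hmul
  have hsum : (q + z * Complex.I).re + (q - z * Complex.I).re = 2 * q.re := by
    simp only [Complex.add_re, Complex.sub_re]
    ring
  by_contra! hle
  have : (q - z * Complex.I).re ≤ 0 := by
    rw [hinv, Complex.inv_re]
    exact div_nonpos_of_nonpos_of_nonneg hle (Complex.normSq_nonneg _)
  linarith

theorem Complex.sq_cpow_half (z : ℂ) : (z ^ (1 / 2 : ℂ)) ^ 2 = z := by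
  rw [← Complex.cpow_nat_mul]
  norm_num

/-- Away from the cuts this exhibits `reArcsin` as the real part of an analytic function, whence
harmonicity. The point `α = -i log p` satisfies `sin α = z` and `Re α = arg p ∈ (-π/2, π/2)`. -/
theorem reArcsin_eq {z : ℂ} (hz : 1 - z ^ 2 ∈ Complex.slitPlane) :
    reArcsin z =
      (-Complex.I * Complex.log ((1 - z ^ 2) ^ (1 / 2 : ℂ) + z * Complex.I)).re := by
  set q := (1 - z ^ 2) ^ (1 / 2 : ℂ) with hq
  have hqz : q ^ 2 = 1 - z ^ 2 := Complex.sq_cpow_half _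
  have hpos := Complex.re_sqrt_add_mul_I_pos (Complex.re_sqrt_pos hz) hqz
  set p := q + z * Complex.I with hp
  have hp0 : p ≠ 0 := fun h => by simp [h] at hpos
  have hinv : q - z * Complex.I = p⁻¹ := eq_inv_of_mul_eq_one_right <| by
    linear_combination hqz - z ^ 2 * Complex.I_sq
  set α := -Complex.I * Complex.log p with hα
  have hre : α.re = Complex.arg p := by simp [hα, Complex.log_im]
  have hsin : Complex.sin α = z := by
    have e : α * Complex.I = Complex.log p := by
      linear_combination (-Complex.log p) * Complex.I_sq
    rw [Complex.sin, neg_mul, e, Complex.exp_neg, Complex.exp_log hp0, ← hinv, hp]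
    linear_combination (-z) * Complex.I_sq
  have harg := abs_lt.1 (Complex.abs_arg_lt_pi_div_two_iff.2 (Or.inl hpos))
  conv_lhs => rw [← hsin]
  exact reArcsin_sin (by linarith [harg.1]) (by linarith [harg.2])

theorem harmonicAt_reArcsin_comp {f : ℂ → ℂ} {k : ℂ} (hf : AnalyticAt ℂ f k)
    (hk : 1 - f k ^ 2 ∈ Complex.slitPlane) :
    InnerProductSpace.HarmonicAt (fun z => reArcsin (f z)) k := by
  have hg : AnalyticAt ℂ (fun z => 1 - f z ^ 2) k := analyticAt_const.sub (hf.pow 2)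
  have hev : (fun z => reArcsin (f z)) =ᶠ[𝓝 k] fun z => (-Complex.I *
      Complex.log ((1 - f z ^ 2) ^ (1 / 2 : ℂ) + f z * Complex.I)).re := by
    filter_upwards [hg.continuousAt.preimage_mem_nhds (Complex.isOpen_slitPlane.mem_nhds hk)]
      with z hz
    exact reArcsin_eq hz
  rw [InnerProductSpace.harmonicAt_congr_nhds hev]
  refine AnalyticAt.harmonicAt_re (analyticAt_const.mul (AnalyticAt.clog ?_ ?_))
  · exact (hg.cpow analyticAt_const hk).add (hf.mul analyticAt_const)
  · exact Or.inl (Complex.re_sqrt_add_mul_I_pos (Complex.re_sqrt_pos hk) (Complex.sq_cpow_half _))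

theorem reArcsin_of_re_eq_zero {z : ℂ} (hz : z.re = 0) : reArcsin z = 0 := by
  have : ‖1 + z‖ = ‖1 - z‖ := by
    rw [← sq_eq_sq₀ (norm_nonneg _) (norm_nonneg _), Complex.sq_norm, Complex.sq_norm,
      Complex.normSq_apply, Complex.normSq_apply]
    simp [hz]
  simp [reArcsin, this]

theorem reArcsin_ofReal_of_one_le {x : ℝ} (hx : 1 ≤ x) : reArcsin x = Real.pi / 2 := by
  rw [reArcsin, ← Complex.ofReal_one, ← Complex.ofReal_add, ← Complex.ofReal_sub,
    Complex.norm_real, Complex.norm_real, Real.norm_eq_abs, Real.norm_eq_abs,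
    abs_of_nonneg (by linarith), abs_of_nonpos (by linarith), Real.arcsin_eq_pi_div_two]
  linarith

theorem reArcsin_ofReal {x : ℝ} (h₀ : 0 ≤ x) (h₁ : x ≤ 1) : reArcsin x = Real.arcsin x := by
  rw [reArcsin, ← Complex.ofReal_one, ← Complex.ofReal_add, ← Complex.ofReal_sub,
    Complex.norm_real, Complex.norm_real, Real.norm_eq_abs, Real.norm_eq_abs,
    abs_of_nonneg (by linarith), abs_of_nonneg (by linarith)]
  congr 1
  ring

theorem abs_reArcsin_le (z : ℂ) : |reArcsin z| ≤ Real.pi / 2 :=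
  abs_le.2 ⟨Real.neg_pi_div_two_le_arcsin _, Real.arcsin_le_pi_div_two _⟩

theorem mem_slitPlane_one_sub_sq {z : ℂ} (hz : ¬(z.im = 0 ∧ 1 ≤ |z.re|)) :
    1 - z ^ 2 ∈ Complex.slitPlane := by
  rw [Complex.mem_slitPlane_iff]
  by_contra! h
  obtain ⟨h1, h2⟩ := h
  simp only [sq, Complex.sub_re, Complex.one_re, Complex.mul_re, Complex.sub_im, Complex.one_im,
    Complex.mul_im] at h1 h2
  have h3 : z.re * z.im = 0 := by linarith
  rcases mul_eq_zero.1 h3 with h | h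
  · nlinarith [sq_nonneg z.im]
  · refine hz ⟨h, ?_⟩
    rw [← one_le_sq_iff_one_le_abs]
    nlinarith

/-! ### Existence -/

theorem Complex.sinh_nat_mul (n : ℕ) (k : ℂ) :
    Complex.sinh (n * k) = ((Real.sinh (n * k.re) * Real.cos (n * k.im) : ℝ) : ℂ) +
      ((Real.cosh (n * k.re) * Real.sin (n * k.im) : ℝ) : ℂ) * Complex.I := by
  have : (n : ℂ) * k = ((n * k.re : ℝ) : ℂ) + ((n * k.im : ℝ) : ℂ) * Complex.I := by
    conv_lhs => rw [← Complex.re_add_im k]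
    push_cast
    ring
  rw [this, Complex.sinh_add, Complex.sinh_mul_I, Complex.cosh_mul_I]
  push_cast
  ring

theorem Complex.sinh_nat_mul_re (n : ℕ) (k : ℂ) :
    (Complex.sinh (n * k)).re = Real.sinh (n * k.re) * Real.cos (n * k.im) := by
  rw [Complex.sinh_nat_mul, Complex.add_re, Complex.ofReal_re, Complex.re_ofReal_mul,
    Complex.I_re, mul_zero, add_zero]

theorem Complex.sinh_nat_mul_im (n : ℕ) (k : ℂ) :
    (Complex.sinh (n * k)).im = Real.cosh (n * k.re) * Real.sin (n * k.im) := by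
  rw [Complex.sinh_nat_mul, Complex.add_im, Complex.ofReal_im, Complex.im_ofReal_mul,
    Complex.I_im, mul_one, zero_add]

/-- The harmonic measure `(2/π) Re arcsin (sinh (n k₀) / sinh (n k))` of the slit. -/
noncomputable def slitMeasure (n : ℕ) (k₀ : ℝ) (k : ℂ) : ℝ :=
  2 / Real.pi * reArcsin ((Real.sinh (n * k₀) : ℂ) / Complex.sinh (n * k))

theorem slitMeasure_ofReal (n : ℕ) (k₀ k : ℝ) :
    slitMeasure n k₀ k =
      2 / Real.pi * reArcsin ((Real.sinh (n * k₀) / Real.sinh (n * k) : ℝ) : ℂ) := by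
  simp [slitMeasure]

theorem sinh_nat_mul_pos {n : ℕ} (hn : 1 ≤ n) {x : ℝ} (hx : 0 < x) : 0 < Real.sinh (n * x) :=
  Real.sinh_pos_iff.2 (mul_pos (by exact_mod_cast hn) hx)

theorem slitMeasure_eq_one {n : ℕ} (hn : 1 ≤ n) {k₀ k : ℝ} (hk : 0 < k) (hk' : k ≤ k₀) :
    slitMeasure n k₀ k = 1 := by
  rw [slitMeasure_ofReal, reArcsin_ofReal_of_one_le]
  · field_simp
  · rw [one_le_div (sinh_nat_mul_pos hn hk), Real.sinh_le_sinh]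
    gcongr

theorem abs_nat_mul_le {n : ℕ} (hn : 1 ≤ n) {y : ℝ} (hy : |y| ≤ Real.pi / (2 * (n : ℝ))) :
    |n * y| ≤ Real.pi / 2 := by
  have hn' : (0 : ℝ) < n := by exact_mod_cast hn
  rw [abs_mul, abs_of_pos hn']
  calc (n : ℝ) * |y| ≤ n * (Real.pi / (2 * (n : ℝ))) := by gcongr
    _ = Real.pi / 2 := by field_simp

theorem eq_zero_of_sin_nat_mul_eq_zero {n : ℕ} (hn : 1 ≤ n) {y : ℝ}
    (hy : |y| ≤ Real.pi / (2 * (n : ℝ))) (h : Real.sin (n * y) = 0) : y = 0 := by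
  have hn' : (n : ℝ) ≠ 0 := by positivity
  have h1 := abs_le.1 (abs_nat_mul_le hn hy)
  have := (Real.sin_eq_zero_iff_of_lt_of_lt (by linarith [Real.pi_pos]) (by linarith [Real.pi_pos])).1 h
  exact (mul_eq_zero.1 this).resolve_left hn'

theorem sinh_nat_mul_ne_zero {n : ℕ} (hn : 1 ≤ n) {k : ℂ} (hk : k ≠ 0)
    (him : |k.im| ≤ Real.pi / (2 * (n : ℝ))) : Complex.sinh (n * k) ≠ 0 := by
  intro h
  have hn' : (n : ℝ) ≠ 0 := by positivity
  have h1 := congrArg Complex.re h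
  have h2 := congrArg Complex.im h
  rw [Complex.sinh_nat_mul_re, Complex.zero_re] at h1
  rw [Complex.sinh_nat_mul_im, Complex.zero_im] at h2
  have hy : k.im = 0 := eq_zero_of_sin_nat_mul_eq_zero hn him
    ((mul_eq_zero.1 h2).resolve_left (Real.cosh_pos _).ne')
  rw [hy, mul_zero, Real.cos_zero, mul_one, Real.sinh_eq_zero] at h1
  exact hk (Complex.ext ((mul_eq_zero.1 h1).resolve_left hn') hy)

theorem isSlitHarmonicMeasure_slitMeasure {n : ℕ} (hn : 1 ≤ n) {k₀ : ℝ} (hk₀ : 0 < k₀) :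
    IsSlitHarmonicMeasure (Real.pi / (2 * (n : ℝ))) k₀ (slitMeasure n k₀) where
  harmonic := by
    rintro k ⟨⟨hre, him⟩, hslit⟩
    have hk : k ≠ 0 := fun h => by simp [h] at hre
    have hs : Complex.sinh (n * k) ≠ 0 := sinh_nat_mul_ne_zero hn hk him.le
    have ha := sinh_nat_mul_pos hn hk₀
    refine InnerProductSpace.HarmonicAt.const_smul (c := 2 / Real.pi)
      (harmonicAt_reArcsin_comp ?_ (mem_slitPlane_one_sub_sq ?_))
    · refine analyticAt_const.div (Differentiable.analyticAt ?_ k) hs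
      fun_prop
    -- A real quotient of modulus at least `1` forces `k` to be real with `k ≤ k₀`, that is, on the
    -- slit.
    · rintro ⟨hz_im, hz_re⟩
      have him0 : (Complex.sinh (n * k)).im = 0 := by
        rw [Complex.div_im, Complex.ofReal_im, Complex.ofReal_re, zero_mul, zero_div, zero_sub,
          neg_eq_zero, div_eq_zero_iff, mul_eq_zero, Complex.normSq_eq_zero] at hz_im
        exact (hz_im.resolve_right hs).resolve_left ha.ne'
      rw [Complex.sinh_nat_mul_im] at him0
      have hy : k.im = 0 := eq_zero_of_sin_nat_mul_eq_zero hn him.le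
        ((mul_eq_zero.1 him0).resolve_left (Real.cosh_pos _).ne')
      have hkr : k = (k.re : ℂ) := Complex.ext rfl (by simpa using hy)
      have hpos := sinh_nat_mul_pos hn hre
      rw [hkr, ← Complex.ofReal_natCast, ← Complex.ofReal_mul, ← Complex.ofReal_sinh,
        ← Complex.ofReal_div, Complex.ofReal_re, abs_of_pos (div_pos ha hpos), one_le_div hpos,
        Real.sinh_le_sinh] at hz_re
      exact hslit ⟨hy, hre, le_of_mul_le_mul_left hz_re (by exact_mod_cast hn)⟩
  bounded := ⟨2 / Real.pi * (Real.pi / 2), fun k _ => by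
    rw [slitMeasure, abs_mul, abs_of_pos (by positivity)]
    exact mul_le_mul_of_nonneg_left (abs_reArcsin_le _) (by positivity)⟩
  continuousOn := by
    -- `reArcsin` is continuous across its cuts, so the slit needs no separate treatment.
    refine continuousOn_const.mul (continuous_reArcsin.comp_continuousOn ?_)
    refine continuousOn_const.div (Continuous.continuousOn (by fun_prop)) ?_
    rintro k ⟨hk, hk0⟩
    exact sinh_nat_mul_ne_zero hn hk0 ((mem_closure_halfStrip (by positivity)).1 hk).2
  eq_zero := by
    intro k hk
    obtain ⟨-, hk⟩ := (mem_frontier_halfStrip (by positivity)).1 hk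
    -- The boundary goes to the imaginary axis. At `k = 0` the quotient is `0` by the convention `x
    -- / 0 = 0`, which gives the required value there.
    have hre : (Complex.sinh (n * k)).re = 0 := by
      rw [Complex.sinh_nat_mul_re]
      rcases hk with h | h
      · simp [h]
      · have : (n : ℝ) * |k.im| = Real.pi / 2 := by
          rw [h]
          field_simp
        rw [← Real.cos_abs, abs_mul, Nat.abs_cast, this, Real.cos_pi_div_two, mul_zero]
    rw [slitMeasure, reArcsin_of_re_eq_zero, mul_zero]
    rw [Complex.div_re, hre, Complex.ofReal_im]
    simp
  eq_one := by
    rintro k ⟨hy, hre, hle⟩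
    rw [show k = (k.re : ℂ) from Complex.ext rfl (by simpa using hy)]
    exact slitMeasure_eq_one hn hre hle

theorem slitMeasure_of_le {n : ℕ} (hn : 1 ≤ n) {k₀ k : ℝ} (hk₀ : 0 < k₀) (hk : k₀ ≤ k) :
    slitMeasure n k₀ k =
      2 / Real.pi * Real.arcsin (Real.sinh (n * k₀) / Real.sinh (n * k)) := by
  have h₀ := sinh_nat_mul_pos hn hk₀
  have h := sinh_nat_mul_pos hn (hk₀.trans_le hk)
  rw [slitMeasure_ofReal, reArcsin_ofReal (by positivity)]
  rw [div_le_one h, Real.sinh_le_sinh]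
  gcongr

/-! ### The bounds -/

theorem Real.arctan_div_sqrt {p q : ℝ} (hp : 0 < p) (hpq : p < q) :
    Real.arctan (p / Real.sqrt (q ^ 2 - p ^ 2)) = Real.arcsin (p / q) := by
  have hq : 0 < q := hp.trans hpq
  have hlt : p / q < 1 := (div_lt_one hq).2 hpq
  have hpos : 0 < p / q := div_pos hp hq
  rw [Real.arcsin_eq_arctan ⟨by linarith, hlt⟩]
  have e : 1 - (p / q) ^ 2 = (q ^ 2 - p ^ 2) / q ^ 2 := by field_simp
  rw [e, Real.sqrt_div' _ (sq_nonneg q), Real.sqrt_sq hq.le]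
  congr 1
  field_simp

/-- `sinh` is convex on `[0, ∞)` and vanishes at `0`, so its graph lies below the chord from `0` to
`n k`. -/
theorem sinh_div_sinh_le_div {n : ℕ} (hn : 1 ≤ n) {k₀ k : ℝ} (hk₀ : 0 < k₀) (hk : k₀ < k) :
    Real.sinh (n * k₀) / Real.sinh (n * k) ≤ k₀ / k := by
  have hn' : (0 : ℝ) < n := by exact_mod_cast hn
  have hkpos := hk₀.trans hk
  have hconv : ConvexOn ℝ (Ici 0) Real.sinh := by
    refine MonotoneOn.convexOn_of_deriv (convex_Ici 0) Real.continuous_sinh.continuousOn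
      Real.differentiable_sinh.differentiableOn ?_
    rw [Real.deriv_sinh]
    exact Real.cosh_strictMonoOn.monotoneOn.mono interior_subset
  have h := hconv.2 (mem_Ici.2 le_rfl) (mem_Ici.2 (by positivity : 0 ≤ n * k))
    (sub_nonneg.2 ((div_le_one hkpos).2 hk.le)) (by positivity : 0 ≤ k₀ / k) (by ring)
  have e : k₀ / k * (n * k) = n * k₀ := by field_simp
  simp only [smul_eq_mul, mul_zero, zero_add, Real.sinh_zero, e] at h
  rwa [div_le_iff₀ (sinh_nat_mul_pos hn hkpos)]

/-- Equivalently, `sinh (n x) / exp (n x) = (1 - exp (-2 n x)) / 2` increases with `x`. -/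
theorem sinh_div_sinh_le_exp_div_exp {n : ℕ} (hn : 1 ≤ n) {k₀ k : ℝ} (hk₀ : 0 < k₀) (hk : k₀ < k) :
    Real.sinh (n * k₀) / Real.sinh (n * k) ≤ Real.exp (k₀ * n) / Real.exp (k * n) := by
  have hle : Real.exp (n * k₀) ≤ Real.exp (n * k) := Real.exp_le_exp.2 (by gcongr)
  have h₀ := Real.exp_pos (n * k₀)
  have h := Real.exp_pos (n * k)
  rw [div_le_div_iff₀ (sinh_nat_mul_pos hn (hk₀.trans hk)) (Real.exp_pos _), mul_comm k₀,
    mul_comm k, Real.sinh_eq, Real.sinh_eq, Real.exp_neg, Real.exp_neg]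
  have e : Real.exp (n * k₀) * (Real.exp (n * k))⁻¹ ≤ (Real.exp (n * k₀))⁻¹ * Real.exp (n * k) := by
    have h1 : Real.exp (n * k₀) * (Real.exp (n * k))⁻¹ ≤ 1 := mul_inv_le_one_of_le₀ hle h.le
    have h2 : 1 ≤ (Real.exp (n * k₀))⁻¹ * Real.exp (n * k) := by
      rw [inv_mul_eq_div]
      exact (one_le_div h₀).2 hle
    exact h1.trans h2
  linarith

theorem sinh_nat_mul_eq (n : ℕ) (k : ℝ) :
    Real.sinh (n * k) = ((Real.exp k ^ 2) ^ n - 1) / (2 * Real.exp k ^ n) := by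
  have := (Real.exp_pos k).ne'
  rw [Real.sinh_eq, Real.exp_neg, Real.exp_nat_mul, pow_right_comm]
  field_simp

/-- The function `(E²ⁿ - 1) / (E (E - 1))ⁿ` is decreasing on `E > 1`. -/
theorem sq_pow_sub_one_mul_le {n : ℕ} (hn : 1 ≤ n) {x y : ℝ} (hx : 1 < x) (hxy : x ≤ y) :
    ((y ^ 2) ^ n - 1) * (x * (x - 1)) ^ n ≤ ((x ^ 2) ^ n - 1) * (y * (y - 1)) ^ n := by
  obtain ⟨m, rfl⟩ : ∃ m, n = m + 1 := ⟨n - 1, by omega⟩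
  -- Factor `E²ⁿ - 1` as `(∑ E²ʲ) (E² - 1)`: `m` of the `n = m + 1` factors `E (E - 1)` go with the
  -- sum, compared termwise, and one with `E² - 1`.
  have hterm : ∀ j ∈ Finset.range (m + 1),
      (y ^ 2) ^ j * (x * (x - 1)) ^ m ≤ (x ^ 2) ^ j * (y * (y - 1)) ^ m := by
    intro j hj
    obtain ⟨i, rfl⟩ := Nat.exists_eq_add_of_le (Nat.lt_succ_iff.1 (Finset.mem_range.1 hj))
    have h1 : y ^ 2 * (x * (x - 1)) ≤ x ^ 2 * (y * (y - 1)) := by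
      nlinarith [mul_nonneg (mul_nonneg (by linarith : 0 ≤ x) (by linarith : 0 ≤ y))
        (sub_nonneg.2 hxy)]
    have h2 : x * (x - 1) ≤ y * (y - 1) := by nlinarith
    have h3 : 0 ≤ x * (x - 1) := mul_nonneg (by linarith) (by linarith)
    have h4 : 0 ≤ y * (y - 1) := h3.trans h2
    calc (y ^ 2) ^ j * (x * (x - 1)) ^ (j + i)
        = (y ^ 2 * (x * (x - 1))) ^ j * (x * (x - 1)) ^ i := by
          simp only [mul_pow, pow_add]
          ring
      _ ≤ (x ^ 2 * (y * (y - 1))) ^ j * (y * (y - 1)) ^ i := by gcongr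
      _ = (x ^ 2) ^ j * (y * (y - 1)) ^ (j + i) := by
          simp only [mul_pow, pow_add]
          ring
  have hsum := Finset.sum_le_sum hterm
  rw [← Finset.sum_mul, ← Finset.sum_mul] at hsum
  have hx1 : 0 ≤ x * (x - 1) := mul_nonneg (by linarith) (by linarith)
  have hfac : (y ^ 2 - 1) * (x * (x - 1)) ≤ (x ^ 2 - 1) * (y * (y - 1)) := by
    have : 0 ≤ (x - 1) * (y - 1) * (y - x) :=
      mul_nonneg (mul_nonneg (by linarith) (by linarith)) (by linarith)
    nlinarith
  rw [← geom_sum_mul (x ^ 2), ← geom_sum_mul (y ^ 2), pow_succ (x * (x - 1)), pow_succ (y * (y - 1))]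
  have hsx : 0 ≤ (∑ i ∈ Finset.range (m + 1), (x ^ 2) ^ i) * (y * (y - 1)) ^ m :=
    mul_nonneg (Finset.sum_nonneg fun i _ => by positivity)
      (pow_nonneg (mul_nonneg (by linarith) (by linarith)) m)
  have := mul_le_mul hsum hfac (mul_nonneg (by nlinarith) hx1) hsx
  linarith

/-- With `E = exp k`, `sinh (n k) / (E - 1)ⁿ` is half the decreasing function of
`sq_pow_sub_one_mul_le`. -/
theorem exp_sub_one_pow_div_le {n : ℕ} (hn : 1 ≤ n) {k₀ k : ℝ} (hk₀ : 0 < k₀) (hk : k₀ < k) :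
    (Real.exp k₀ - 1) ^ n / (Real.exp k - 1) ^ n ≤ Real.sinh (n * k₀) / Real.sinh (n * k) := by
  have hx : 1 < Real.exp k₀ := Real.one_lt_exp_iff.2 hk₀
  have hxy : Real.exp k₀ ≤ Real.exp k := Real.exp_le_exp.2 hk.le
  have hx0 := pow_pos (Real.exp_pos k₀) n
  have hy0 := pow_pos (Real.exp_pos k) n
  have h := sq_pow_sub_one_mul_le hn hx hxy
  rw [div_le_div_iff₀ (pow_pos (by linarith) n) (sinh_nat_mul_pos hn (hk₀.trans hk)),
    sinh_nat_mul_eq, sinh_nat_mul_eq, mul_div_assoc', div_mul_eq_mul_div,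
    div_le_div_iff₀ (by positivity) (by positivity)]
  rw [mul_pow, mul_pow] at h
  linarith

/-- The slit half-strip has exactly one harmonic measure `w₀` (existence and uniqueness on the
closed half-strip), and it obeys the two bounds at every real `k > k₀`.  At `k = k₀` the quotients
have denominator `0`, both bounds mean `(2/π) arctan(+∞) = 1`, and the claim reads `w₀ k₀ = 1`. -/
theorem lemma6p2 (n : ℕ) (hn : 1 ≤ n) (k₀ : ℝ) (hk₀ : 0 < k₀) :
    ∃ w₀ : ℂ → ℝ,
      IsSlitHarmonicMeasure (Real.pi / (2 * (n : ℝ))) k₀ w₀ ∧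
      (∀ w : ℂ → ℝ, IsSlitHarmonicMeasure (Real.pi / (2 * (n : ℝ))) k₀ w →
        Set.EqOn w w₀ (closure (halfStrip (Real.pi / (2 * (n : ℝ)))))) ∧
      w₀ (k₀ : ℂ) = 1 ∧
      ∀ k : ℝ, k₀ < k →
        2 / Real.pi * Real.arctan ((Real.exp k₀ - 1) ^ n /
            Real.sqrt ((Real.exp k - 1) ^ (2 * n) - (Real.exp k₀ - 1) ^ (2 * n)))
          ≤ w₀ (k : ℂ) ∧
        w₀ (k : ℂ) ≤ 2 / Real.pi * Real.arctan
          (min (k₀ / Real.sqrt (k ^ 2 - k₀ ^ 2))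
            (Real.exp (k₀ * n) / Real.sqrt (Real.exp (2 * k * n) - Real.exp (2 * k₀ * n)))) := by
  have hw := isSlitHarmonicMeasure_slitMeasure hn hk₀
  refine ⟨slitMeasure n k₀, hw, fun w h => h.eqOn (by positivity) hw,
    slitMeasure_eq_one hn hk₀ le_rfl, fun k hk => ?_⟩
  have hlt : Real.exp k₀ < Real.exp k := Real.exp_lt_exp.2 hk
  have hx : 1 < Real.exp k₀ := Real.one_lt_exp_iff.2 hk₀
  rw [slitMeasure_of_le hn hk₀ hk.le]
  constructor
  · rw [mul_comm 2 n, pow_mul, pow_mul, Real.arctan_div_sqrt (pow_pos (by linarith) n)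
      (pow_lt_pow_left₀ (by linarith) (by linarith) (by omega))]
    exact mul_le_mul_of_nonneg_left
      (Real.arcsin_le_arcsin (exp_sub_one_pow_div_le hn hk₀ hk)) (by positivity)
  · have hsq : ∀ x : ℝ, Real.exp (2 * x * n) = Real.exp (x * n) ^ 2 := fun x => by
      rw [← Real.exp_nat_mul]
      congr 1
      push_cast
      ring
    rw [Real.arctan_strictMono.monotone.map_min, hsq, hsq, Real.arctan_div_sqrt hk₀ hk,
      Real.arctan_div_sqrt (Real.exp_pos _) (Real.exp_lt_exp.2 (by gcongr))]
    exact mul_le_mul_of_nonneg_left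
      (le_min (Real.arcsin_le_arcsin (sinh_div_sinh_le_div hn hk₀ hk))
        (Real.arcsin_le_arcsin (sinh_div_sinh_le_exp_div_exp hn hk₀ hk))) (by positivity)
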